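/- Let $m\in\mathbb N$ and let $U\subset\mathbb R^m$ be open. Let $\mathcal{DM}_\infty(U)$ be the set of all $u\in L_\infty(U;\mathbb R^m)$ whose distributional divergence is a finite signed Borel measure $\operatorname{div}u$ on $U$, i.e. $\int_U u\cdot\nabla\varphi\,dx=-\int_U\varphi\,d\operatorname{div}u$ for all $\varphi\in C_c^\infty(U)$. Let $\bar{\mathcal S}(U)$ be the completion, with respect to the $(m-1)$-dimensional Hausdorff measure on $U$, of the $\sigma$-algebra generated by the Suslin (analytic) subsets of $U$. For a bounded, $\bar{\mathcal S}(U)$-measurable function $f\colon U\to\mathbb R$ put $$\|f\|_{BF(U)}=\sup\Big\{\int_U f\,d\operatorname{div}u \;:\; u\in\mathcal{DM}_\infty(U),\ \|u\|_{L_\infty(U;\mathbb R^m)}\le 1\Big\}\in[0,\infty];$$ $f$ has bounded fluctuation in $U$ if $\|f\|_{BF(U)}<\infty$. The set $U$ has finite anexometer if its indicator function $\chi_U$ has bounded fluctuation in $U$, and infinite anexometer otherwise. (a) If $m\ge 2$ and $U\subset\mathbb R^m$ is an open set with infinite Lebesgue measure, then $\|\chi_U\|_{BF(U)}=\infty$;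 that is, $U$ has infinite anexometer. (b) This fails for $m=1$: the set $\mathbb R$ has infinite Lebesgue measure, but $\|\chi_{\mathbb R}\|_{BF(\mathbb R)}=2$, so $\mathbb R$ has finite anexometer. -/

import Mathlib

open MeasureTheory

noncomputable section

/-- Lebesgue measure on (the subtype of points of) `U`. -/
def lebesgueOn {m : ℕ} (U : Set (EuclideanSpace ℝ (Fin m))) : Measure U :=
  Measure.comap ((↑) : U → EuclideanSpace ℝ (Fin m)) volume

/-- `IsDistribDiv U u ν`: the finite signed Borel measure `ν` on `U` is the distributional divergence
of the vector field `u`, that is `∫_U ∇φ · u dx = - ∫_U φ dν` for all test functions `φ` on `U`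
(here `fderiv ℝ φ x (u x)` is `∇φ(x) · u(x)`). -/
def IsDistribDiv {m : ℕ} (U : Set (EuclideanSpace ℝ (Fin m))) (u : U → EuclideanSpace ℝ (Fin m))
    (ν : SignedMeasure U) : Prop :=
  ∀ φ : EuclideanSpace ℝ (Fin m) → ℝ, ContDiff ℝ ((⊤ : ℕ∞) : WithTop ℕ∞) φ →
    HasCompactSupport φ → tsupport φ ⊆ U →
      ∫ x : U, fderiv ℝ φ (x : EuclideanSpace ℝ (Fin m)) (u x) ∂(lebesgueOn U) = - ∫ᵛ x, φ (x : U) ∂•ν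

/-- The bounded fluctuation seminorm of `f : U → ℝ`, i.e. the supremum in `[-∞, ∞]` of `∫_U f d(div u)`
over all bounded divergence measure fields `u` (`u ∈ L_∞(U; ℝᵐ)` whose distributional divergence is
a finite signed Borel measure) with essential supremum norm at most `1`. -/
def bfSeminorm {m : ℕ} (U : Set (EuclideanSpace ℝ (Fin m))) (f : U → ℝ) : EReal :=
  sSup {r : EReal | ∃ (u : U → EuclideanSpace ℝ (Fin m)) (ν : SignedMeasure U),
    MemLp u ⊤ (lebesgueOn U) ∧ IsDistribDiv U u ν ∧
      eLpNorm u ⊤ (lebesgueOn U) ≤ 1 ∧ r = ((∫ᵛ x, f x ∂•ν : ℝ) : EReal)}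

/-- The σ-algebra generated by the Suslin (analytic) subsets of a topological space. -/
abbrev suslinSigmaAlgebra (X : Type*) [TopologicalSpace X] : MeasurableSpace X :=
  MeasurableSpace.generateFrom {A : Set X | AnalyticSet A}

/-- `A` belongs to the completion of the Suslin σ-algebra of `U` with respect to
the `(m - 1)`-dimensional Hausdorff measure on `U`. -/
def IsCompletedSuslinSet {m : ℕ} (U : Set (EuclideanSpace ℝ (Fin m))) (A : Set U) : Prop :=
  ∃ S : Set U, MeasurableSet[suslinSigmaAlgebra U] S ∧
    (Measure.hausdorffMeasure ((m : ℝ) - 1) : Measure U) (symmDiff A S) = 0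

/-- `f : U → ℝ` is a function of bounded fluctuation in `U`: it is bounded, measurable with respect
to the completed Suslin σ-algebra, and its bounded fluctuation seminorm is finite. -/
def HasBoundedFluctuation {m : ℕ} (U : Set (EuclideanSpace ℝ (Fin m))) (f : U → ℝ) : Prop :=
  (∃ C : ℝ, ∀ x, |f x| ≤ C) ∧
    (∀ B : Set ℝ, MeasurableSet B → IsCompletedSuslinSet U (f ⁻¹' B)) ∧
    bfSeminorm U f < ⊤

/-- The indicator function of `U`, as a function on `U`. -/
def chi {m : ℕ} (U : Set (EuclideanSpace ℝ (Fin m))) (x : U) : ℝ :=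
  U.indicator (fun _ => 1) (x : EuclideanSpace ℝ (Fin m))

/-- `U` has finite anexometer (in itself): its indicator function has bounded fluctuation in `U`. -/
def HasFiniteAnexometer {m : ℕ} (U : Set (EuclideanSpace ℝ (Fin m))) : Prop :=
  HasBoundedFluctuation U (chi U)

end

/-! Part (a). Suppose `χ_U` has fluctuation at most `C`. A global `C¹` field `u` with `|u| ≤ 1` and
integrable divergence restricts to a competitor on `U`, whatever it does at `∂U`, so `∫_U div u ≤
C`. This inequality is used with two families of fields.

Radial fields at scale `R` have positive divergence, of order at least `1/R` on the ball `B_R`.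
Hence `|U ∩ B_R|` grows at most linearly in `R` (`volume_inter_ball_le_of_bfSeminorm_le`).

Fields `η w e_i`, with `η` a cutoff at scale `R` and `|w| ≤ 1`, bound the total variation of `η χ_U`
by `C + (K/R) |U ∩ B_{3R}|` in each coordinate direction (`integral_abs_fderiv_mollification_le`,
after mollification). Linear growth makes this bound independent of `R`. The
Gagliardo–Nirenberg–Sobolev inequality with exponent `m/(m-1)` then bounds `|U ∩ B_R|` uniformly
(`lintegral_pow_le_of_mollification`), so `|U| < ∞`. The exponent is finite only for `m ≥ 2`.

Part (b). On the line, the mass of `div u` is the difference of the values of `u` at the two ends,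
hence at most `2`. The field `x / √(1 + x²)` attains this value. -/

open scoped Convolution Topology

/-! ### Integration against signed measures -/

/-- Integration against a signed measure with density. -/
theorem integral_withDensityᵥ {X : Type*} [MeasurableSpace X] {μ : Measure X} {g φ : X → ℝ}
    (hg : Integrable g μ) (hφ : Measurable φ) {C : ℝ} (hC : ∀ x, |φ x| ≤ C) :
    ∫ᵛ x, φ x ∂•(μ.withDensityᵥ g) = ∫ x, φ x * g x ∂μ := by
  have hflip : (ContinuousLinearMap.lsmul ℝ ℝ : ℝ →L[ℝ] ℝ →L[ℝ] ℝ)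
      = (ContinuousLinearMap.lsmul ℝ ℝ : ℝ →L[ℝ] ℝ →L[ℝ] ℝ).flip := by
    ext; simp
  have hb : ∀ (ν : Measure X) [IsFiniteMeasure ν], Integrable φ ν := fun ν _ =>
    Integrable.of_bound hφ.aestronglyMeasurable C (Filter.Eventually.of_forall hC)
  -- Used for `g` and for `-g`, whose positive parts are the positive and negative parts of the
  -- density.
  have hpos : ∀ f : X → ℝ, Integrable f μ →
      ∫ x, φ x ∂(μ.withDensity fun x => ENNReal.ofReal (f x)) = ∫ x, φ x * max (f x) 0 ∂μ := by
    intro f hf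
    have h0 : AEMeasurable (fun x => Real.toNNReal (f x)) μ := hf.aemeasurable.real_toNNReal
    have := integral_withDensity_eq_integral_smul₀ h0 φ
    simp only [ENNReal.ofReal]
    rw [this]
    refine integral_congr_ae (Filter.Eventually.of_forall fun x => ?_)
    simp [NNReal.smul_def, mul_comm]
  have := isFiniteMeasure_withDensity_ofReal hg.2
  have := isFiniteMeasure_withDensity_ofReal hg.neg.2
  rw [withDensityᵥ_eq_withDensity_pos_part_sub_withDensity_neg_part hg,
    VectorMeasure.integral_sub_vectorMeasure, hflip]
  · rw [VectorMeasure.integral_toSignedMeasure, VectorMeasure.integral_toSignedMeasure,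
      hpos g hg]
    have hn := hpos _ hg.neg
    simp only [Pi.neg_apply] at hn
    rw [hn, ← integral_sub]
    · refine integral_congr_ae (Filter.Eventually.of_forall fun x => ?_)
      simp only [← mul_sub]
      rcases le_total 0 (g x) with h | h
      · rw [max_eq_left h, max_eq_right (by linarith)]; simp
      · rw [max_eq_right h, max_eq_left (by linarith)]; simp
    · exact hg.pos_part.bdd_mul hφ.aestronglyMeasurable (Filter.Eventually.of_forall hC)
    · exact hg.neg_part.bdd_mul hφ.aestronglyMeasurable (Filter.Eventually.of_forall hC)
  · simpa [VectorMeasure.Integrable] using hb _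
  · simpa [VectorMeasure.Integrable] using hb _

theorem integral_lebesgueOn {m : ℕ} {U : Set (EuclideanSpace ℝ (Fin m))} (hU : MeasurableSet U)
    (F : EuclideanSpace ℝ (Fin m) → ℝ) :
    ∫ x : U, F x ∂(lebesgueOn U) = ∫ x in U, F x :=
  integral_subtype_comap hU F

theorem chi_apply {m : ℕ} {U : Set (EuclideanSpace ℝ (Fin m))} (x : U) : chi U x = 1 := by
  simp [chi]

instance {m : ℕ} {U : Set (EuclideanSpace ℝ (Fin m))} (ν : SignedMeasure U) :
    IsFiniteMeasure ν.variation := by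
  rw [← SignedMeasure.totalVariation_eq_variation]
  infer_instance

theorem integral_chi {m : ℕ} {U : Set (EuclideanSpace ℝ (Fin m))} (ν : SignedMeasure U) :
    ∫ᵛ x, chi U x ∂•ν = ν Set.univ := by
  simp [chi_apply]

/-! ### Smooth fields as competitors -/

/-- The divergence of a vector field. -/
noncomputable def divergence {m : ℕ}
    (u : EuclideanSpace ℝ (Fin m) → EuclideanSpace ℝ (Fin m)) (x : EuclideanSpace ℝ (Fin m)) : ℝ :=
  ∑ i, fderiv ℝ u x (EuclideanSpace.single i 1) i

theorem integral_fderiv_apply_eq_neg_integral_mul_divergence {m : ℕ}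
    {u : EuclideanSpace ℝ (Fin m) → EuclideanSpace ℝ (Fin m)} (hu : ContDiff ℝ 1 u)
    {φ : EuclideanSpace ℝ (Fin m) → ℝ} (hφ : ContDiff ℝ 1 φ) (hc : HasCompactSupport φ) :
    ∫ x, fderiv ℝ φ x (u x) = - ∫ x, φ x * divergence u x := by
  have hφ' := hφ.continuous_fderiv one_ne_zero
  have hu' := hu.continuous_fderiv one_ne_zero
  have hfd : HasCompactSupport (fderiv ℝ φ) := hc.fderiv ℝ
  have huc := hu.continuous
  have hexp : ∀ x, fderiv ℝ φ x (u x)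
      = ∑ i, fderiv ℝ φ x (EuclideanSpace.single i 1) * u x i := by
    intro x
    conv_lhs => rw [← (EuclideanSpace.basisFun (Fin m) ℝ).sum_repr (u x)]
    simp [mul_comm]
  have hcomp : ∀ (x : EuclideanSpace ℝ (Fin m)) v i, fderiv ℝ (fun y => u y i) x v
      = fderiv ℝ u x v i := by
    intro x v i
    have h := (hu.differentiable one_ne_zero x).hasFDerivAt
    have := ((EuclideanSpace.proj i : EuclideanSpace ℝ (Fin m) →L[ℝ] ℝ).hasFDerivAt.comp x h).fderiv
    exact congrArg (fun L => L v) this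
  have hui : ∀ i, ContDiff ℝ 1 (fun y => u y i) := fun i =>
    (EuclideanSpace.proj i : EuclideanSpace ℝ (Fin m) →L[ℝ] ℝ).contDiff.comp hu
  have hI1 : ∀ i, Integrable fun x => fderiv ℝ φ x (EuclideanSpace.single i 1) * u x i := by
    intro i
    refine Continuous.integrable_of_hasCompactSupport (by fun_prop) ?_
    refine HasCompactSupport.mul_right ?_
    exact hfd.comp_left (g := fun L : EuclideanSpace ℝ (Fin m) →L[ℝ] ℝ =>
      L (EuclideanSpace.single i 1)) (by simp)
  have hI2 : ∀ i, Integrable fun x => φ x * fderiv ℝ u x (EuclideanSpace.single i 1) i := by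
    intro i
    exact Continuous.integrable_of_hasCompactSupport (by fun_prop) hc.mul_right
  simp only [hexp, divergence, Finset.mul_sum]
  rw [integral_finsetSum _ fun i _ => hI1 i, integral_finsetSum _ fun i _ => hI2 i,
    ← Finset.sum_neg_distrib]
  refine Finset.sum_congr rfl fun i _ => ?_
  have := integral_mul_fderiv_eq_neg_fderiv_mul_of_integrable (μ := volume) (f := φ)
    (g := fun y => u y i) (v := EuclideanSpace.single i 1) (hI1 i) (by simpa [hcomp] using hI2 i)
    (Continuous.integrable_of_hasCompactSupport (by fun_prop) hc.mul_right)
    (fun x _ => hφ.differentiable one_ne_zero x)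
    (fun x _ => (hui i).differentiable one_ne_zero x)
  simp only [hcomp] at this
  rw [this, neg_neg]

/-- A `C¹` field on the whole space bounded by `1` with integrable divergence bounds the
bounded fluctuation of the indicator from below. -/
theorem setIntegral_divergence_le_bfSeminorm {m : ℕ} {U : Set (EuclideanSpace ℝ (Fin m))}
    (hU : IsOpen U) {u : EuclideanSpace ℝ (Fin m) → EuclideanSpace ℝ (Fin m)}
    (hu : ContDiff ℝ 1 u) (h1 : ∀ x, ‖u x‖ ≤ 1) (hd : Integrable (divergence u)) :
    ((∫ x in U, divergence u x : ℝ) : EReal) ≤ bfSeminorm U (chi U) := by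
  have hUm := hU.measurableSet
  have hdU : Integrable (fun x : U => divergence u x) (lebesgueOn U) := by
    have : IntegrableOn (divergence u) U := hd.integrableOn
    rwa [integrableOn_iff_comap_subtypeVal hUm] at this
  have hmeas : AEStronglyMeasurable (fun x : U => u x) (lebesgueOn U) :=
    (hu.continuous.comp continuous_subtype_val).aestronglyMeasurable
  refine le_sSup ⟨fun x => u x, (lebesgueOn U).withDensityᵥ fun x => divergence u x,
    memLp_top_of_bound hmeas 1 (Filter.Eventually.of_forall fun x => h1 x), ?_, ?_, ?_⟩
  -- Test functions are supported inside `U`, so both integrals extend to the whole space. No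
  -- condition on `u` along the boundary of `U` is needed.
  · intro φ hφ hc hs
    obtain ⟨C, hC⟩ := hc.exists_bound_of_continuous hφ.continuous
    rw [integral_withDensityᵥ (φ := fun x : U => φ x) hdU
      (hφ.continuous.measurable.comp measurable_subtype_coe) (fun x => hC x),
      integral_lebesgueOn hUm (fun x => fderiv ℝ φ x (u x)),
      integral_lebesgueOn hUm (fun x => φ x * divergence u x),
      setIntegral_eq_integral_of_forall_compl_eq_zero,
      setIntegral_eq_integral_of_forall_compl_eq_zero]
    · exact integral_fderiv_apply_eq_neg_integral_mul_divergence hu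
        (hφ.of_le (by simp)) hc
    · intro x hx
      rw [image_eq_zero_of_notMem_tsupport fun h => hx (hs h), zero_mul]
    · intro x hx
      rw [fderiv_of_notMem_tsupport (𝕜 := ℝ) fun h => hx (hs h)]; rfl
  · rw [eLpNorm_exponent_top]
    have := eLpNormEssSup_le_of_ae_bound (μ := lebesgueOn U) (f := fun x : U => u x) (C := 1)
      (Filter.Eventually.of_forall fun x => h1 x)
    simpa using this
  · rw [integral_chi, withDensityᵥ_apply hdU MeasurableSet.univ, setIntegral_univ,
      integral_lebesgueOn hUm]

/-! ### Radial fields and linear volume growth -/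

/-- A radial vector field of constant flux at infinity, with length scale `a⁻¹`. -/
noncomputable def radialField (m : ℕ) (a : ℝ) (x : EuclideanSpace ℝ (Fin m)) :
    EuclideanSpace ℝ (Fin m) :=
  (a * (1 + a ^ 2 * ‖x‖ ^ 2) ^ (-(m : ℝ) / 2)) • x

theorem contDiff_radialField (m : ℕ) (a : ℝ) : ContDiff ℝ 1 (radialField m a) := by
  have h : ContDiff ℝ 1 fun x : EuclideanSpace ℝ (Fin m) =>
      (1 + a ^ 2 * ‖x‖ ^ 2) ^ (-(m : ℝ) / 2) :=
    ContDiff.rpow_const_of_ne (contDiff_const.add (contDiff_const.mul (contDiff_norm_sq ℝ)))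
      fun x => by positivity
  exact (contDiff_const.mul h).smul contDiff_id

/-- With `s = a‖x‖`, the norm is `s (1 + s²)^(-m/2)`, and since `m ≥ 1` this is at most `s / √(1 +
s²) ≤ 1`. -/
theorem norm_radialField_le {m : ℕ} (hm : 1 ≤ m) {a : ℝ} (ha : 0 ≤ a)
    (x : EuclideanSpace ℝ (Fin m)) : ‖radialField m a x‖ ≤ 1 := by
  have hm' : (1 : ℝ) ≤ m := by exact_mod_cast hm
  have h1 : 1 ≤ 1 + a ^ 2 * ‖x‖ ^ 2 := by nlinarith [mul_nonneg (sq_nonneg a) (sq_nonneg ‖x‖)]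
  have h2 : (1 + a ^ 2 * ‖x‖ ^ 2) ^ (-(m : ℝ) / 2) ≤ (√(1 + a ^ 2 * ‖x‖ ^ 2))⁻¹ := by
    rw [Real.sqrt_eq_rpow, ← Real.rpow_neg (by positivity)]
    exact Real.rpow_le_rpow_of_exponent_le h1 (by linarith)
  have h3 : a * ‖x‖ ≤ √(1 + a ^ 2 * ‖x‖ ^ 2) := by
    apply Real.le_sqrt_of_sq_le; nlinarith
  have h4 : 0 < √(1 + a ^ 2 * ‖x‖ ^ 2) := Real.sqrt_pos.2 (by positivity)
  rw [radialField, norm_smul, Real.norm_of_nonneg (by positivity)]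
  calc a * (1 + a ^ 2 * ‖x‖ ^ 2) ^ (-(m : ℝ) / 2) * ‖x‖
      = (a * ‖x‖) * (1 + a ^ 2 * ‖x‖ ^ 2) ^ (-(m : ℝ) / 2) := by ring
    _ ≤ √(1 + a ^ 2 * ‖x‖ ^ 2) * (√(1 + a ^ 2 * ‖x‖ ^ 2))⁻¹ := by gcongr
    _ = 1 := mul_inv_cancel₀ h4.ne'

theorem divergence_radialField (m : ℕ) (a : ℝ) (x : EuclideanSpace ℝ (Fin m)) :
    divergence (radialField m a) x
      = m * a * (1 + a ^ 2 * ‖x‖ ^ 2) ^ (-((m : ℝ) + 2) / 2) := by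
  have hp : 0 < 1 + a ^ 2 * ‖x‖ ^ 2 := by positivity
  have h0 := (((hasStrictFDerivAt_norm_sq x).hasFDerivAt.const_mul (a ^ 2)).const_add 1)
  have h1 := (h0.rpow_const (p := -(m : ℝ) / 2) (Or.inl hp.ne')).const_mul a
  have h2 := (h1.smul (hasFDerivAt_id x)).fderiv
  have h3 : fderiv ℝ (radialField m a) x = _ := h2
  have he : (-(m : ℝ) / 2 - 1) = -((m : ℝ) + 2) / 2 := by ring
  -- Once the lower power is factored out, the bracket `m (1 + s²) - m s²`, with `s = a‖x‖`,
  -- collapses to `m`. This is why the divergence is positive everywhere.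
  have hs : (1 + a ^ 2 * ‖x‖ ^ 2) ^ (-(m : ℝ) / 2)
      = (1 + a ^ 2 * ‖x‖ ^ 2) * (1 + a ^ 2 * ‖x‖ ^ 2) ^ (-((m : ℝ) + 2) / 2) := by
    rw [← he, Real.rpow_sub_one hp.ne']; field_simp
  have hn : ‖x‖ ^ 2 = ∑ i, x i * x i := by
    rw [EuclideanSpace.real_norm_sq_eq]; simp [sq]
  unfold divergence
  rw [h3]
  have hterm : ∀ i, ((a * (1 + a ^ 2 * ‖x‖ ^ 2) ^ (-(m : ℝ) / 2)) •
      ContinuousLinearMap.id ℝ (EuclideanSpace ℝ (Fin m)) +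
      (a • (-(m : ℝ) / 2 * (1 + a ^ 2 * ‖x‖ ^ 2) ^ (-(m : ℝ) / 2 - 1)) • a ^ 2 • 2 •
        (innerSL ℝ) x).smulRight (id x)) (EuclideanSpace.single i 1) i
      = a * (1 + a ^ 2 * ‖x‖ ^ 2) ^ (-(m : ℝ) / 2)
        + (-(m * a ^ 3 * (1 + a ^ 2 * ‖x‖ ^ 2) ^ (-((m : ℝ) + 2) / 2))) * (x i * x i) := by
    intro i
    rw [he]
    simp [EuclideanSpace.inner_single_right]
    ring
  rw [Finset.sum_congr rfl fun i _ => hterm i, Finset.sum_add_distrib, Finset.sum_const,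
    ← Finset.mul_sum, ← hn, hs]
  simp
  ring

theorem integrable_divergence_radialField (m : ℕ) {a : ℝ} (ha : a ≠ 0) :
    Integrable (divergence (radialField m a)) := by
  have h : Integrable fun x : EuclideanSpace ℝ (Fin m) =>
      ((1 : ℝ) + ‖x‖ ^ 2) ^ (-((m : ℝ) + 2) / 2) :=
    integrable_rpow_neg_one_add_norm_sq (by simp)
  have h' := (h.comp_smul ha).const_mul (m * a)
  refine h'.congr (Filter.Eventually.of_forall fun x => ?_)
  simp only [divergence_radialField, norm_smul, mul_pow, Real.norm_eq_abs, sq_abs]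

/-- If the indicator of `U` has fluctuation at most `C`, then `U` has linear volume growth. -/
theorem volume_inter_ball_le_of_bfSeminorm_le {m : ℕ} (hm : 1 ≤ m)
    {U : Set (EuclideanSpace ℝ (Fin m))} (hU : IsOpen U) {C : ℝ}
    (hC : bfSeminorm U (chi U) ≤ C) {R : ℝ} (hR : 0 < R) :
    volume.real (U ∩ Metric.ball 0 R) ≤ C * 2 ^ (((m : ℝ) + 2) / 2) * R := by
  have hm' : (1 : ℝ) ≤ m := by exact_mod_cast hm
  have h1 := (setIntegral_divergence_le_bfSeminorm hU (contDiff_radialField m R⁻¹)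
    (norm_radialField_le hm (by positivity))
    (integrable_divergence_radialField m (by positivity))).trans hC
  rw [EReal.coe_le_coe_iff] at h1
  have hI := integrable_divergence_radialField m (inv_ne_zero hR.ne')
  have hnn : ∀ x, 0 ≤ divergence (radialField m R⁻¹) x := fun x => by
    rw [divergence_radialField]; positivity
  have hfin : volume (U ∩ Metric.ball 0 R) ≠ ⊤ :=
    ((measure_mono Set.inter_subset_right).trans_lt Metric.isBounded_ball.measure_lt_top).ne
  have hsm : MeasurableSet (U ∩ Metric.ball 0 R) := hU.measurableSet.inter measurableSet_ball
  -- On the ball the base `1 + ‖x‖²/R²` is at most `2`, and the factor `m ≥ 1` is dropped.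
  have hlow : ∀ x ∈ U ∩ Metric.ball 0 R,
      R⁻¹ * 2 ^ (-((m : ℝ) + 2) / 2) ≤ divergence (radialField m R⁻¹) x := by
    intro x hx
    have hx2 : ‖x‖ < R := by simpa using hx.2
    have hle : 1 + R⁻¹ ^ 2 * ‖x‖ ^ 2 ≤ 2 := by
      have : R⁻¹ * ‖x‖ ≤ 1 := by rw [inv_mul_le_iff₀ hR]; linarith
      have h0 : 0 ≤ R⁻¹ * ‖x‖ := by positivity
      nlinarith
    rw [divergence_radialField]
    have := Real.rpow_le_rpow_of_nonpos (z := -((m : ℝ) + 2) / 2) (by positivity) hle (by linarith)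
    calc R⁻¹ * 2 ^ (-((m : ℝ) + 2) / 2)
        ≤ R⁻¹ * (1 + R⁻¹ ^ 2 * ‖x‖ ^ 2) ^ (-((m : ℝ) + 2) / 2) := by gcongr
      _ ≤ m * (R⁻¹ * (1 + R⁻¹ ^ 2 * ‖x‖ ^ 2) ^ (-((m : ℝ) + 2) / 2)) :=
        le_mul_of_one_le_left (by positivity) hm'
      _ = _ := by ring
  have h2 : volume.real (U ∩ Metric.ball 0 R) * (R⁻¹ * 2 ^ (-((m : ℝ) + 2) / 2)) ≤ C := by
    calc volume.real (U ∩ Metric.ball 0 R) * (R⁻¹ * 2 ^ (-((m : ℝ) + 2) / 2))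
        = ∫ x in U ∩ Metric.ball 0 R, R⁻¹ * 2 ^ (-((m : ℝ) + 2) / 2) := by simp
      _ ≤ ∫ x in U ∩ Metric.ball 0 R, divergence (radialField m R⁻¹) x :=
        setIntegral_mono_on (integrableOn_const hfin) hI.integrableOn hsm hlow
      _ ≤ ∫ x in U, divergence (radialField m R⁻¹) x :=
        setIntegral_mono_set hI.integrableOn (Filter.Eventually.of_forall hnn)
          (Filter.Eventually.of_forall fun x hx => hx.1)
      _ ≤ C := h1
  have h3 : (2 : ℝ) ^ (-((m : ℝ) + 2) / 2) = (2 ^ (((m : ℝ) + 2) / 2))⁻¹ := by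
    rw [neg_div, Real.rpow_neg (by norm_num)]
  rw [h3, ← mul_inv, ← div_eq_mul_inv, div_le_iff₀ (by positivity)] at h2
  linarith

/-! ### Total variation bounds by duality and mollification -/

/-- A `C¹` function with compact support whose integral against every `C¹` test function bounded
by `1` is at most `C` has `L¹` norm at most `C`. -/
theorem integral_abs_le_of_forall_integral_mul_le {m : ℕ} {k : EuclideanSpace ℝ (Fin m) → ℝ}
    (hk : ContDiff ℝ 1 k) (hc : HasCompactSupport k) {C : ℝ}
    (H : ∀ w : EuclideanSpace ℝ (Fin m) → ℝ, ContDiff ℝ 1 w → HasCompactSupport w →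
      (∀ x, |w x| ≤ 1) → ∫ x, k x * w x ≤ C) :
    ∫ x, |k x| ≤ C := by
  have hfin : volume (tsupport k) ≠ ⊤ := hc.isCompact.measure_lt_top.ne
  have hkc := hk.continuous
  have hIk : Integrable fun x => |k x| :=
    (hkc.integrable_of_hasCompactSupport hc).abs
  -- `k / √(k² + δ²)` is a `C¹` substitute for the sign of `k`. It loses at most `δ` pointwise, and
  -- only on the support, which has finite volume.
  have key : ∀ δ : ℝ, 0 < δ → ∫ x, |k x| ≤ C + δ * volume.real (tsupport k) := by
    intro δ hδ
    have hpos : ∀ x, 0 < √(k x ^ 2 + δ ^ 2) := fun x => Real.sqrt_pos.2 (by positivity)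
    have hw : ContDiff ℝ 1 fun x => k x / √(k x ^ 2 + δ ^ 2) :=
      hk.div (((hk.pow 2).add contDiff_const).sqrt fun x => by positivity) fun x => (hpos x).ne'
    have hwc : HasCompactSupport fun x => k x / √(k x ^ 2 + δ ^ 2) := by
      simp only [div_eq_mul_inv]
      exact hc.mul_right
    have h1 := H _ hw hwc fun x => by
      rw [abs_div, abs_of_pos (hpos x), div_le_one (hpos x)]
      exact Real.abs_le_sqrt (by nlinarith)
    have hI : Integrable fun x => k x * (k x / √(k x ^ 2 + δ ^ 2)) :=
      (hkc.mul hw.continuous).integrable_of_hasCompactSupport hc.mul_right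
    have hI2 : Integrable ((tsupport k).indicator fun _ => δ) :=
      (integrable_indicator_iff (isClosed_tsupport k).measurableSet).2 (integrableOn_const hfin)
    have hpt : ∀ x, |k x| ≤ k x * (k x / √(k x ^ 2 + δ ^ 2)) + (tsupport k).indicator (fun _ => δ) x := by
      intro x
      by_cases hx : x ∈ tsupport k
      · have hs : √(k x ^ 2 + δ ^ 2) ≤ |k x| + δ := by
          rw [Real.sqrt_le_left (by positivity)]
          nlinarith [sq_abs (k x), mul_nonneg (abs_nonneg (k x)) hδ.le]
        have : |k x| - δ ≤ k x * (k x / √(k x ^ 2 + δ ^ 2)) := by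
          rw [← mul_div_assoc, le_div_iff₀ (hpos x)]
          rcases le_total (|k x|) δ with h | h
          · nlinarith [hpos x, mul_self_nonneg (k x)]
          · nlinarith [mul_le_mul_of_nonneg_left hs (sub_nonneg.2 h), sq_abs (k x)]
        simp only [Set.indicator_of_mem hx]
        linarith
      · rw [image_eq_zero_of_notMem_tsupport hx, Set.indicator_of_notMem hx]; simp
    calc ∫ x, |k x| ≤ ∫ x, (k x * (k x / √(k x ^ 2 + δ ^ 2))
          + (tsupport k).indicator (fun _ => δ) x) := integral_mono hIk (hI.add hI2) hpt
      _ ≤ C + δ * volume.real (tsupport k) := by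
        rw [integral_add hI hI2, integral_indicator (isClosed_tsupport k).measurableSet]
        simp only [setIntegral_const, smul_eq_mul]
        linarith
  refine le_of_forall_pos_le_add fun ε hε => ?_
  have hv : 0 ≤ volume.real (tsupport k) := measureReal_nonneg
  refine (key (ε / (volume.real (tsupport k) + 1)) (by positivity)).trans ?_
  have : ε / (volume.real (tsupport k) + 1) * volume.real (tsupport k) ≤ ε := by
    rw [div_mul_eq_mul_div, div_le_iff₀ (by positivity)]
    nlinarith
  linarith

/-- Convolution with an even bounded kernel is symmetric. -/
theorem integral_convolution_mul {m : ℕ} {ρ h v : EuclideanSpace ℝ (Fin m) → ℝ}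
    (hρ : Continuous ρ) {B : ℝ} (hB : ∀ x, |ρ x| ≤ B) (heven : ∀ x, ρ (-x) = ρ x)
    (hh : Integrable h) (hv : Integrable v) :
    ∫ x, (ρ ⋆[ContinuousLinearMap.lsmul ℝ ℝ, volume] h) x * v x
      = ∫ x, h x * (ρ ⋆[ContinuousLinearMap.lsmul ℝ ℝ, volume] v) x := by
  simp only [convolution_eq_swap, ContinuousLinearMap.lsmul_apply, smul_eq_mul]
  simp only [← integral_mul_const, ← integral_const_mul]
  rw [integral_integral_swap]
  · refine integral_congr_ae (Filter.Eventually.of_forall fun y => ?_)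
    refine integral_congr_ae (Filter.Eventually.of_forall fun x => ?_)
    simp only
    rw [← heven (x - y), neg_sub]; ring
  · have h1 : Integrable (fun p : EuclideanSpace ℝ (Fin m) × EuclideanSpace ℝ (Fin m) =>
        v p.1 * h p.2) (volume.prod volume) := hv.mul_prod hh
    have h2 := h1.bdd_mul (f := fun p : EuclideanSpace ℝ (Fin m) × EuclideanSpace ℝ (Fin m) =>
      ρ (p.1 - p.2)) (c := B) (by fun_prop) (Filter.Eventually.of_forall fun p => hB _)
    refine h2.congr (Filter.Eventually.of_forall fun p => ?_)
    simp only [Function.uncurry]; ring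

/-- The competitor is `η w e_i`. Its divergence is `η ∂_i w + w ∂_i η`, and the second term is at
most `K` in size and lives on the ball. -/
theorem setIntegral_mul_fderiv_le_of_bfSeminorm_le {m : ℕ}
    {U : Set (EuclideanSpace ℝ (Fin m))} (hU : IsOpen U) {C : ℝ}
    (hC : bfSeminorm U (chi U) ≤ C) {η w : EuclideanSpace ℝ (Fin m) → ℝ}
    (hη : ContDiff ℝ 1 η) (hη1 : ∀ x, |η x| ≤ 1) {R : ℝ} (hηR : tsupport η ⊆ Metric.ball 0 R)
    {K : ℝ} (hK : ∀ x, ‖fderiv ℝ η x‖ ≤ K)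
    (hw : ContDiff ℝ 1 w) (hw1 : ∀ x, |w x| ≤ 1) (i : Fin m) :
    ∫ x in U, η x * fderiv ℝ w x (EuclideanSpace.single i 1)
      ≤ C + K * volume.real (U ∩ Metric.ball 0 R) := by
  set e : EuclideanSpace ℝ (Fin m) := EuclideanSpace.single i 1 with he
  have hηc : HasCompactSupport η :=
    (isCompact_closedBall (0 : EuclideanSpace ℝ (Fin m)) R).of_isClosed_subset
      (isClosed_tsupport η) (hηR.trans Metric.ball_subset_closedBall)
  have hcη := hη.continuous
  have hcw := hw.continuous
  have hcη' := hη.continuous_fderiv one_ne_zero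
  have hcw' := hw.continuous_fderiv one_ne_zero
  have hu : ContDiff ℝ 1 fun x => (η x * w x) • e := (hη.mul hw).smul contDiff_const
  have hdiv : ∀ x, divergence (fun x => (η x * w x) • e) x
      = η x * fderiv ℝ w x e + w x * fderiv ℝ η x e := by
    intro x
    have h1 := ((hη.differentiable one_ne_zero x).hasFDerivAt.mul
      (hw.differentiable one_ne_zero x).hasFDerivAt).smul_const e
    have h2 : fderiv ℝ (fun x => (η x * w x) • e) x = _ := h1.fderiv
    unfold divergence
    rw [h2]
    simp [he]
  have hI1 : Integrable fun x => η x * fderiv ℝ w x e :=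
    (by fun_prop : Continuous fun x => η x * fderiv ℝ w x e).integrable_of_hasCompactSupport
      hηc.mul_right
  have hI2 : Integrable fun x => w x * fderiv ℝ η x e := by
    refine (by fun_prop : Continuous fun x => w x * fderiv ℝ η x e).integrable_of_hasCompactSupport ?_
    refine HasCompactSupport.mul_left ?_
    exact (hηc.fderiv ℝ).comp_left (g := fun L : EuclideanSpace ℝ (Fin m) →L[ℝ] ℝ => L e) (by simp)
  have h1 := (setIntegral_divergence_le_bfSeminorm hU hu (fun x => by
    rw [norm_smul, norm_mul]
    simpa [he] using mul_le_one₀ (hη1 x) (abs_nonneg _) (hw1 x)) (by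
      refine (hI1.add hI2).congr (Filter.Eventually.of_forall fun x => ?_)
      simp [hdiv])).trans hC
  rw [EReal.coe_le_coe_iff] at h1
  simp only [hdiv] at h1
  rw [integral_add hI1.integrableOn hI2.integrableOn] at h1
  have hfin : volume (U ∩ Metric.ball 0 R) < ⊤ :=
    (measure_mono Set.inter_subset_right).trans_lt Metric.isBounded_ball.measure_lt_top
  have h2 : |∫ x in U, w x * fderiv ℝ η x e| ≤ K * volume.real (U ∩ Metric.ball 0 R) := by
    have : ∫ x in U, w x * fderiv ℝ η x e
        = ∫ x in U ∩ Metric.ball 0 R, w x * fderiv ℝ η x e := by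
      refine setIntegral_eq_of_subset_of_forall_sdiff_eq_zero hU.measurableSet
        Set.inter_subset_left fun x hx => ?_
      rw [fderiv_of_notMem_tsupport (𝕜 := ℝ) fun h => hx.2 ⟨hx.1, hηR h⟩]
      simp
    rw [this, ← Real.norm_eq_abs]
    refine norm_setIntegral_le_of_norm_le_const hfin fun x _ => ?_
    rw [norm_mul]
    calc ‖w x‖ * ‖fderiv ℝ η x e‖ ≤ 1 * (‖fderiv ℝ η x‖ * ‖e‖) := by
          gcongr
          · exact hw1 x
          · exact ContinuousLinearMap.le_opNorm _ _
      _ ≤ K := by simpa [he] using hK x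
  have := (abs_le.1 h2).1
  linarith

/-- Mollification cannot increase total variation: in the dual pairing the derivative and the even
kernel both move onto the test function `w`, and `ρ ⋆ w` is again bounded by `1`. -/
theorem integral_abs_fderiv_mollification_le {m : ℕ}
    {U : Set (EuclideanSpace ℝ (Fin m))} (hU : IsOpen U) {C : ℝ}
    (hC : bfSeminorm U (chi U) ≤ C) {η : EuclideanSpace ℝ (Fin m) → ℝ}
    (hη : ContDiff ℝ 1 η) (hη1 : ∀ x, |η x| ≤ 1) {R : ℝ} (hηR : tsupport η ⊆ Metric.ball 0 R)
    {K : ℝ} (hK : ∀ x, ‖fderiv ℝ η x‖ ≤ K)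
    (b : ContDiffBump (0 : EuclideanSpace ℝ (Fin m))) (i : Fin m) :
    ∫ x, |fderiv ℝ (b.normed volume ⋆[ContinuousLinearMap.lsmul ℝ ℝ, volume] U.indicator η) x
      (EuclideanSpace.single i 1)| ≤ C + K * volume.real (U ∩ Metric.ball 0 R) := by
  set e : EuclideanSpace ℝ (Fin m) := EuclideanSpace.single i 1
  set ρ := b.normed (volume : Measure (EuclideanSpace ℝ (Fin m)))
  set h := U.indicator η
  set g := ρ ⋆[ContinuousLinearMap.lsmul ℝ ℝ, volume] h
  have hηc : HasCompactSupport η :=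
    (isCompact_closedBall (0 : EuclideanSpace ℝ (Fin m)) R).of_isClosed_subset
      (isClosed_tsupport η) (hηR.trans Metric.ball_subset_closedBall)
  have hIh : Integrable h :=
    (hη.continuous.integrable_of_hasCompactSupport hηc).indicator hU.measurableSet
  have hhc : HasCompactSupport h := hηc.mono fun x hx => by
    rw [Function.mem_support] at hx ⊢
    exact fun h0 => hx (by simp [h, h0])
  have hρc : Continuous ρ := b.continuous_normed
  have hρs : HasCompactSupport ρ := b.hasCompactSupport_normed
  have hIρ : Integrable ρ := hρc.integrable_of_hasCompactSupport hρs
  obtain ⟨B, hB⟩ := hρs.exists_bound_of_continuous hρc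
  -- Two derivatives, because the duality lemma asks for `∂_i g` itself to be `C¹`.
  have hg2 : ContDiff ℝ ((2 : ℕ∞) : WithTop ℕ∞) g :=
    hρs.contDiff_convolution_left _ b.contDiff_normed hIh.locallyIntegrable
  have hgc : HasCompactSupport g := hρs.convolution _ hhc
  have hg1 : ContDiff ℝ 1 g := hg2.of_le (by norm_num)
  have hk : ContDiff ℝ 1 fun x => fderiv ℝ g x e :=
    (hg2.fderiv_right (m := 1) (by norm_num)).clm_apply contDiff_const
  have hkc : HasCompactSupport fun x => fderiv ℝ g x e :=
    (hgc.fderiv ℝ).comp_left (g := fun L : EuclideanSpace ℝ (Fin m) →L[ℝ] ℝ => L e) (by simp)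
  refine integral_abs_le_of_forall_integral_mul_le hk hkc fun w hw hwc hw1 => ?_
  have hw'c : Continuous fun x => fderiv ℝ w x e :=
    (hw.continuous_fderiv one_ne_zero).clm_apply continuous_const
  have hw's : HasCompactSupport fun x => fderiv ℝ w x e :=
    (hwc.fderiv ℝ).comp_left (g := fun L : EuclideanSpace ℝ (Fin m) →L[ℝ] ℝ => L e) (by simp)
  set W := ρ ⋆[ContinuousLinearMap.lsmul ℝ ℝ, volume] w
  have hW : ContDiff ℝ 1 W :=
    hwc.contDiff_convolution_right (n := 1) _ hIρ.locallyIntegrable hw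
  have hWd : ∀ x, fderiv ℝ W x e
      = (ρ ⋆[ContinuousLinearMap.lsmul ℝ ℝ, volume] fun a => fderiv ℝ w a e) x := by
    intro x
    rw [(hwc.hasFDerivAt_convolution_right (ContinuousLinearMap.lsmul ℝ ℝ)
      hIρ.locallyIntegrable hw x).fderiv]
    exact convolution_precompR_apply _ hIρ.locallyIntegrable (hwc.fderiv ℝ)
      (hw.continuous_fderiv one_ne_zero) x e
  have hW1 : ∀ x, |W x| ≤ 1 := by
    intro x
    rw [← Real.norm_eq_abs, ← b.integral_normed (μ := volume)]
    refine norm_integral_le_of_norm_le hIρ (Filter.Eventually.of_forall fun t => ?_)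
    simp only [ContinuousLinearMap.lsmul_apply, norm_smul]
    rw [Real.norm_of_nonneg (b.nonneg_normed t)]
    exact mul_le_of_le_one_right (b.nonneg_normed t) (hw1 _)
  -- Testing with `-W` absorbs the minus sign from the integration by parts.
  have hmain := setIntegral_mul_fderiv_le_of_bfSeminorm_le hU hC hη hη1 hηR hK hW.neg
    (fun x => by simpa using hW1 x) i
  refine le_trans (le_of_eq ?_) hmain
  have hibp := integral_mul_fderiv_eq_neg_fderiv_mul_of_integrable (μ := volume) (f := w)
    (g := g) (v := e)
    ((hw'c.mul hg1.continuous).integrable_of_hasCompactSupport hw's.mul_right)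
    ((hw.continuous.mul hk.continuous).integrable_of_hasCompactSupport hwc.mul_right)
    ((hw.continuous.mul hg1.continuous).integrable_of_hasCompactSupport hwc.mul_right)
    (fun x _ => hw.differentiable one_ne_zero x) (fun x _ => hg1.differentiable one_ne_zero x)
  have hadj := integral_convolution_mul hρc hB (fun x => b.normed_neg x) hIh
    (hw'c.integrable_of_hasCompactSupport hw's)
  calc ∫ x, fderiv ℝ g x e * w x = ∫ x, w x * fderiv ℝ g x e := by simp only [mul_comm]
    _ = - ∫ x, g x * fderiv ℝ w x e := by rw [hibp]; simp only [mul_comm]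
    _ = - ∫ x, h x * fderiv ℝ W x e := by rw [hadj]; simp only [hWd]
    _ = ∫ x, U.indicator (fun x => η x * fderiv ℝ (-W) x e) x := by
      rw [← integral_neg]
      refine integral_congr_ae (Filter.Eventually.of_forall fun x => ?_)
      by_cases hx : x ∈ U <;> simp [h, hx, fderiv_neg]
    _ = _ := integral_indicator hU.measurableSet

/-! ### Sobolev inequality and finite volume -/

theorem lintegral_enorm_fderiv_le_sum {m : ℕ} {g : EuclideanSpace ℝ (Fin m) → ℝ}
    (hg : ContDiff ℝ 1 g) (hc : HasCompactSupport g) {C : ℝ}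
    (H : ∀ i, ∫ x, |fderiv ℝ g x (EuclideanSpace.single i 1)| ≤ C) :
    ∫⁻ x, ‖fderiv ℝ g x‖ₑ ≤ ENNReal.ofReal (m * C) := by
  have hd := hg.continuous_fderiv one_ne_zero
  have hI : ∀ i, Integrable fun x => |fderiv ℝ g x (EuclideanSpace.single i 1)| := fun i =>
    ((hd.clm_apply continuous_const).integrable_of_hasCompactSupport
      ((hc.fderiv ℝ).comp_left (g := fun L : EuclideanSpace ℝ (Fin m) →L[ℝ] ℝ =>
        L (EuclideanSpace.single i 1)) (by simp))).abs
  have hId : Integrable (fderiv ℝ g) := hd.integrable_of_hasCompactSupport (hc.fderiv ℝ)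
  have hpt : ∀ L : EuclideanSpace ℝ (Fin m) →L[ℝ] ℝ,
      ‖L‖ ≤ ∑ i, |L (EuclideanSpace.single i 1)| := by
    intro L
    refine L.opNorm_le_bound (Finset.sum_nonneg fun i _ => abs_nonneg _) fun x => ?_
    conv_lhs => rw [← (EuclideanSpace.basisFun (Fin m) ℝ).sum_repr x]
    rw [map_sum, Finset.sum_mul]
    refine (norm_sum_le _ _).trans (Finset.sum_le_sum fun i _ => ?_)
    rw [map_smul, norm_smul, mul_comm]
    simp only [EuclideanSpace.basisFun_apply, EuclideanSpace.basisFun_repr]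
    exact mul_le_mul_of_nonneg_left (PiLp.norm_apply_le x i) (abs_nonneg _)
  simp only [← ofReal_norm]
  rw [← ofReal_integral_eq_lintegral_ofReal hId.norm (Filter.Eventually.of_forall fun x => norm_nonneg _)]
  refine ENNReal.ofReal_le_ofReal ?_
  calc ∫ x, ‖fderiv ℝ g x‖ ≤ ∫ x, ∑ i, |fderiv ℝ g x (EuclideanSpace.single i 1)| :=
        integral_mono hId.norm (integrable_finsetSum _ fun i _ => hI i) fun x => hpt _
    _ = ∑ i, ∫ x, |fderiv ℝ g x (EuclideanSpace.single i 1)| :=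
        integral_finsetSum _ fun i _ => hI i
    _ ≤ ∑ _i : Fin m, C := Finset.sum_le_sum fun i _ => H i
    _ = m * C := by simp

/-- A function whose mollifications satisfy a uniform gradient bound satisfies the
Gagliardo–Nirenberg–Sobolev inequality. -/
theorem lintegral_pow_le_of_mollification {m : ℕ} {h : EuclideanSpace ℝ (Fin m) → ℝ}
    (hI : Integrable h) (hc : HasCompactSupport h) {p : ℝ}
    (hp : (m : ℝ).HolderConjugate p) {C : ℝ}
    (H : ∀ (b : ContDiffBump (0 : EuclideanSpace ℝ (Fin m))) (i : Fin m),
      ∫ x, |fderiv ℝ (b.normed volume ⋆[ContinuousLinearMap.lsmul ℝ ℝ, volume] h) x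
        (EuclideanSpace.single i 1)| ≤ C) :
    ∫⁻ x, ‖h x‖ₑ ^ p ≤
      lintegralPowLePowLIntegralFDerivConst (volume : Measure (EuclideanSpace ℝ (Fin m))) p
        * ENNReal.ofReal (m * C) ^ p := by
  have hp0 : 0 ≤ p := hp.symm.nonneg
  -- The fixed ratio `2` of outer to inner radius is what gives almost everywhere convergence of the
  -- mollifications. Fatou's lemma then passes the bound to `h`.
  let b : ℕ → ContDiffBump (0 : EuclideanSpace ℝ (Fin m)) := fun n =>
    ⟨1 / ((n : ℝ) + 1), 2 * (1 / ((n : ℝ) + 1)), by positivity,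
      lt_mul_of_one_lt_left (by positivity) one_lt_two⟩
  set g : ℕ → EuclideanSpace ℝ (Fin m) → ℝ := fun n =>
    (b n).normed volume ⋆[ContinuousLinearMap.lsmul ℝ ℝ, volume] h
  have hg1 : ∀ n, ContDiff ℝ 1 (g n) := fun n =>
    (b n).hasCompactSupport_normed.contDiff_convolution_left (n := 1) _ (b n).contDiff_normed
      hI.locallyIntegrable
  have hgc : ∀ n, HasCompactSupport (g n) := fun n =>
    (b n).hasCompactSupport_normed.convolution _ hc
  have hb0 : Filter.Tendsto (fun n => (b n).rOut) Filter.atTop (𝓝 0) := by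
    simpa [b] using tendsto_one_div_add_atTop_nhds_zero_nat.const_mul (2 : ℝ)
  have hlim := ContDiffBump.ae_convolution_tendsto_right_of_locallyIntegrable (μ := volume)
    (φ := b) (K := 2) hb0 (Filter.Eventually.of_forall fun n => le_rfl) hI.locallyIntegrable
  have hbound : ∀ n, ∫⁻ x, ‖g n x‖ₑ ^ p ≤
      lintegralPowLePowLIntegralFDerivConst (volume : Measure (EuclideanSpace ℝ (Fin m))) p
        * ENNReal.ofReal (m * C) ^ p := by
    intro n
    refine (lintegral_pow_le_pow_lintegral_fderiv volume (hg1 n) (hgc n) (by simpa using hp)).trans ?_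
    gcongr
    exact lintegral_enorm_fderiv_le_sum (hg1 n) (hgc n) (H (b n))
  calc ∫⁻ x, ‖h x‖ₑ ^ p
      = ∫⁻ x, Filter.liminf (fun n => ‖g n x‖ₑ ^ p) Filter.atTop := by
        refine lintegral_congr_ae ?_
        filter_upwards [hlim] with x hx
        exact (((ENNReal.continuous_rpow_const (y := p)).tendsto _).comp
          hx.enorm).liminf_eq.symm
    _ ≤ Filter.liminf (fun n => ∫⁻ x, ‖g n x‖ₑ ^ p) Filter.atTop :=
        lintegral_liminf_le fun n => by
          have := (hg1 n).continuous
          exact (this.enorm.measurable).pow_const p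
    _ ≤ _ := by
        refine (Filter.liminf_le_liminf (Filter.Eventually.of_forall hbound)).trans_eq ?_
        exact Filter.liminf_const _

/-- In dimension at least two, an open set whose indicator has finite fluctuation has finite
Lebesgue measure. -/
theorem volume_lt_top_of_bfSeminorm_le {m : ℕ} (hm : 2 ≤ m)
    {U : Set (EuclideanSpace ℝ (Fin m))} (hU : IsOpen U) {C : ℝ}
    (hC : bfSeminorm U (chi U) ≤ C) : volume U < ⊤ := by
  have hm' : (1 : ℝ) < m := by exact_mod_cast hm
  -- The conjugate exponent `m/(m-1)` requires `m > 1`; the other ingredients need only `m ≥ 1`.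
  have hp := Real.HolderConjugate.conjExponent hm'
  set p := (m : ℝ).conjExponent
  let f : ContDiffBump (0 : EuclideanSpace ℝ (Fin m)) := ⟨1, 2, one_pos, one_lt_two⟩
  have hf : ContDiff ℝ 1 f := f.contDiff
  obtain ⟨K, hK⟩ := (f.hasCompactSupport.fderiv ℝ).exists_bound_of_continuous
    (hf.continuous_fderiv one_ne_zero)
  -- Linear growth on the ball of radius `3R` times the gradient bound `K/R`: the radius cancels, so
  -- `M` does not depend on `R`.
  set M : ℝ := C + K * (C * 2 ^ (((m : ℝ) + 2) / 2) * 3)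
  set A := lintegralPowLePowLIntegralFDerivConst (volume : Measure (EuclideanSpace ℝ (Fin m))) p
        * ENNReal.ofReal (m * M) ^ p with hA
  have hAtop : A < ⊤ := ENNReal.mul_lt_top ENNReal.coe_lt_top
    (ENNReal.rpow_lt_top_of_nonneg hp.symm.nonneg ENNReal.ofReal_ne_top)
  have hball : ∀ R : ℝ, 0 < R → volume (U ∩ Metric.ball 0 R) ≤ A := by
    intro R hR
    set η : EuclideanSpace ℝ (Fin m) → ℝ := fun x => f (R⁻¹ • x)
    have hη : ContDiff ℝ 1 η := hf.comp (contDiff_const_smul R⁻¹)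
    have hη1 : ∀ x, |η x| ≤ 1 := fun x => by
      rw [abs_of_nonneg f.nonneg]; exact f.le_one
    -- The closed support lies in the closed ball of radius `2R`; `3R` leaves room for an open ball.
    have hηR : tsupport η ⊆ Metric.ball 0 (3 * R) := by
      refine (closure_minimal (fun x hx => ?_) Metric.isClosed_closedBall).trans
        (Metric.closedBall_subset_ball (by linarith : 2 * R < 3 * R))
      have : R⁻¹ • x ∈ Function.support f := hx
      rw [f.support_eq] at this
      simp only [mem_ball_zero_iff, norm_smul, norm_inv, Real.norm_of_nonneg hR.le, f] at this
      rw [inv_mul_lt_iff₀ hR] at this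
      simp only [mem_closedBall_zero_iff]
      linarith
    have hηK : ∀ x, ‖fderiv ℝ η x‖ ≤ K * R⁻¹ := fun x => by
      have : fderiv ℝ η x = R⁻¹ • fderiv ℝ f (R⁻¹ • x) := fderiv_comp_smul R⁻¹
      rw [this, norm_smul, mul_comm, norm_inv, Real.norm_of_nonneg hR.le]
      gcongr
      exact hK _
    have hK0 : 0 ≤ K := (norm_nonneg _).trans (hK 0)
    have hM : C + K * R⁻¹ * volume.real (U ∩ Metric.ball 0 (3 * R)) ≤ M := by
      have := volume_inter_ball_le_of_bfSeminorm_le (by omega) hU hC (by positivity : 0 < 3 * R)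
      have h2 := mul_le_mul_of_nonneg_left this (by positivity : 0 ≤ K * R⁻¹)
      have h3 : K * R⁻¹ * (C * 2 ^ (((m : ℝ) + 2) / 2) * (3 * R))
          = K * (C * 2 ^ (((m : ℝ) + 2) / 2) * 3) := by field_simp
      simp only [M]
      linarith
    have hηc : HasCompactSupport η :=
      (isCompact_closedBall (0 : EuclideanSpace ℝ (Fin m)) (3 * R)).of_isClosed_subset
        (isClosed_tsupport η) (hηR.trans Metric.ball_subset_closedBall)
    have key := lintegral_pow_le_of_mollification
      ((hη.continuous.integrable_of_hasCompactSupport hηc).indicator hU.measurableSet)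
      (hηc.mono fun x hx => by
        rw [Function.mem_support] at hx ⊢
        exact fun h0 => hx (by simp [h0])) hp
      fun b i => (integral_abs_fderiv_mollification_le hU hC hη hη1 hηR hηK b i).trans hM
    refine le_trans ?_ key
    rw [← lintegral_indicator_one (hU.measurableSet.inter measurableSet_ball)]
    refine lintegral_mono fun x => ?_
    by_cases hx : x ∈ U ∩ Metric.ball 0 R
    · have hx1 : η x = 1 := f.one_of_mem_closedBall (by
        have := hx.2
        simp only [mem_ball_zero_iff] at this
        simp only [mem_closedBall_zero_iff, norm_smul, norm_inv, Real.norm_of_nonneg hR.le, f]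
        rw [inv_mul_le_iff₀ hR]
        linarith)
      simp [hx, hx.1, hx1]
    · simp [hx]
  have hmono : Monotone fun n : ℕ => U ∩ Metric.ball (0 : EuclideanSpace ℝ (Fin m)) (n + 1) :=
    fun a b hab => Set.inter_subset_inter_right _ (Metric.ball_subset_ball (by
      have : (a : ℝ) ≤ b := by exact_mod_cast hab
      linarith))
  have hUnion : ⋃ n : ℕ, U ∩ Metric.ball (0 : EuclideanSpace ℝ (Fin m)) (n + 1) = U := by
    rw [← Set.inter_iUnion, Set.inter_eq_left]
    intro x _
    obtain ⟨n, hn⟩ := exists_nat_gt ‖x‖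
    exact Set.mem_iUnion.2 ⟨n, by simp only [mem_ball_zero_iff]; linarith⟩
  have ht := tendsto_measure_iUnion_atTop (μ := volume) hmono
  rw [hUnion] at ht
  exact (le_of_tendsto' ht fun n => hball _ (by positivity)).trans_lt hAtop

/-! ### The real line -/

theorem measurePreserving_apply_zero :
    MeasurePreserving (fun x : EuclideanSpace ℝ (Fin 1) => x 0) volume volume :=
  (volume_preserving_funUnique (Fin 1) ℝ).comp (PiLp.volume_preserving_ofLp (Fin 1))

theorem measurableEmbedding_apply_zero :
    MeasurableEmbedding (fun x : EuclideanSpace ℝ (Fin 1) => x 0) :=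
  ((MeasurableEquiv.toLp 2 (Fin 1 → ℝ)).symm.trans
    (MeasurableEquiv.funUnique (Fin 1) ℝ)).measurableEmbedding

theorem norm_eq_abs_apply_zero (x : EuclideanSpace ℝ (Fin 1)) : ‖x‖ = |x 0| := by
  simp [EuclideanSpace.norm_eq, Real.sqrt_sq_eq_abs]

/-- An antiderivative is `sin ∘ arctan`, that is `t / √(1 + t²)`, with limits `±1`. -/
theorem integral_rpow_neg_three_halves :
    ∫ t : ℝ, (1 + t ^ 2) ^ (-(3 : ℝ) / 2) = 2 := by
  have hpt : ∀ t : ℝ, (1 + t ^ 2) ^ (-(3 : ℝ) / 2)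
      = Real.cos (Real.arctan t) * (1 / (1 + t ^ 2)) := by
    intro t
    have hp : 0 < 1 + t ^ 2 := by positivity
    rw [Real.cos_arctan, Real.sqrt_eq_rpow, show -(3 : ℝ) / 2 = -(1 / 2) - 1 by norm_num,
      Real.rpow_sub_one hp.ne', Real.rpow_neg hp.le]
    simp [div_eq_mul_inv]
  have hI : Integrable fun t : ℝ => (1 + t ^ 2) ^ (-(3 : ℝ) / 2) := by
    have := integrable_rpow_neg_one_add_norm_sq (E := ℝ) (μ := volume) (r := 3) (by simp)
    simpa using this
  have hbot := (Real.continuous_sin.tendsto _).comp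
    (Real.tendsto_arctan_atBot.mono_right nhdsWithin_le_nhds)
  have htop := (Real.continuous_sin.tendsto _).comp
    (Real.tendsto_arctan_atTop.mono_right nhdsWithin_le_nhds)
  have := integral_of_hasDerivAt_of_tendsto (f := Real.sin ∘ Real.arctan)
    (f' := fun t => (1 + t ^ 2) ^ (-(3 : ℝ) / 2)) (fun t => by
      rw [hpt]
      exact (Real.hasDerivAt_sin _).comp t (Real.hasDerivAt_arctan t)) hI hbot htop
  rw [this, Real.sin_neg, Real.sin_pi_div_two]
  norm_num

theorem two_le_bfSeminorm_univ :
    2 ≤ bfSeminorm (Set.univ : Set (EuclideanSpace ℝ (Fin 1))) (chi Set.univ) := by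
  have h := setIntegral_divergence_le_bfSeminorm isOpen_univ (contDiff_radialField 1 1)
    (norm_radialField_le le_rfl zero_le_one) (integrable_divergence_radialField 1 one_ne_zero)
  have h2 : ∫ x in Set.univ, divergence (radialField 1 1) x = 2 := by
    rw [setIntegral_univ, ← integral_rpow_neg_three_halves,
      ← measurePreserving_apply_zero.integral_comp measurableEmbedding_apply_zero]
    refine integral_congr_ae (Filter.Eventually.of_forall fun x => ?_)
    simp only [divergence_radialField, norm_eq_abs_apply_zero, sq_abs]
    norm_num
  rw [h2] at h
  exact_mod_cast h

theorem deriv_smoothTransition_nonneg (t : ℝ) : 0 ≤ deriv Real.smoothTransition t :=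
  Real.smoothTransition.monotone.deriv_nonneg

theorem integrable_deriv_smoothTransition : Integrable (deriv Real.smoothTransition) := by
  have hc : Continuous (deriv Real.smoothTransition) :=
    (Real.smoothTransition.contDiff (n := 1)).continuous_deriv le_rfl
  refine hc.integrable_of_hasCompactSupport
    (HasCompactSupport.intro (isCompact_Icc (a := (0 : ℝ)) (b := 1)) fun t ht => ?_)
  rcases not_and_or.1 ht with h | h
  · have : Real.smoothTransition =ᶠ[𝓝 t] fun _ => 0 :=
      Filter.eventually_of_mem (Iio_mem_nhds (not_le.1 h)) fun s hs =>
        Real.smoothTransition.zero_of_nonpos (le_of_lt hs)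
    rw [this.deriv_eq, deriv_const]
  · have : Real.smoothTransition =ᶠ[𝓝 t] fun _ => 1 :=
      Filter.eventually_of_mem (Ioi_mem_nhds (not_le.1 h)) fun s hs =>
        Real.smoothTransition.one_of_one_le (le_of_lt hs)
    rw [this.deriv_eq, deriv_const]

theorem integral_deriv_smoothTransition : ∫ t, deriv Real.smoothTransition t = 1 := by
  have := integral_of_hasDerivAt_of_tendsto (f := Real.smoothTransition) (m := 0) (n := 1)
    (fun t => ((Real.smoothTransition.contDiff (n := 1)).differentiable one_ne_zero
      t).hasDerivAt) integrable_deriv_smoothTransition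
    (tendsto_const_nhds.congr' ((Filter.eventually_le_atBot 0).mono fun t ht =>
      (Real.smoothTransition.zero_of_nonpos ht).symm))
    (tendsto_const_nhds.congr' ((Filter.eventually_ge_atTop 1).mono fun t ht =>
      (Real.smoothTransition.one_of_one_le ht).symm))
  simpa using this

/-- A smooth cutoff on the line which is `1` on `[1 - a, a]` and vanishes outside `[-a, a + 1]`. -/
noncomputable def lineCutoff (a : ℝ) (x : EuclideanSpace ℝ (Fin 1)) : ℝ :=
  Real.smoothTransition (x 0 + a) - Real.smoothTransition (x 0 - a)

theorem contDiff_lineCutoff (a : ℝ) : ContDiff ℝ ((⊤ : ℕ∞) : WithTop ℕ∞) (lineCutoff a) := by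
  have h0 : ContDiff ℝ ((⊤ : ℕ∞) : WithTop ℕ∞) fun x : EuclideanSpace ℝ (Fin 1) => x 0 :=
    (EuclideanSpace.proj 0 : EuclideanSpace ℝ (Fin 1) →L[ℝ] ℝ).contDiff
  exact (Real.smoothTransition.contDiff.comp (h0.add contDiff_const)).sub
    (Real.smoothTransition.contDiff.comp (h0.sub contDiff_const))

theorem abs_lineCutoff_le (a : ℝ) (x : EuclideanSpace ℝ (Fin 1)) : |lineCutoff a x| ≤ 1 := by
  have h1 := Real.smoothTransition.nonneg (x 0 + a)
  have h2 := Real.smoothTransition.le_one (x 0 + a)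
  have h3 := Real.smoothTransition.nonneg (x 0 - a)
  have h4 := Real.smoothTransition.le_one (x 0 - a)
  rw [lineCutoff, abs_le]
  constructor <;> linarith

theorem hasCompactSupport_lineCutoff {a : ℝ} (ha : 0 ≤ a) : HasCompactSupport (lineCutoff a) := by
  refine HasCompactSupport.intro (isCompact_closedBall (0 : EuclideanSpace ℝ (Fin 1)) (a + 1))
    fun x hx => ?_
  rw [mem_closedBall_zero_iff, norm_eq_abs_apply_zero, not_le, lt_abs] at hx
  rcases hx with h | h
  · rw [lineCutoff, Real.smoothTransition.one_of_one_le (by linarith),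
      Real.smoothTransition.one_of_one_le (by linarith), sub_self]
  · rw [lineCutoff, Real.smoothTransition.zero_of_nonpos (by linarith),
      Real.smoothTransition.zero_of_nonpos (by linarith), sub_self]

theorem lineCutoff_eq_one {a : ℝ} {x : EuclideanSpace ℝ (Fin 1)} (h : |x 0| + 1 ≤ a) :
    lineCutoff a x = 1 := by
  have h1 := neg_abs_le (x 0)
  have h2 := le_abs_self (x 0)
  rw [lineCutoff, Real.smoothTransition.one_of_one_le (by linarith),
    Real.smoothTransition.zero_of_nonpos (by linarith), sub_zero]

/-- The two terms are nonnegative bumps of integral `1`, one at each end of the cutoff. They are the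
source of the constant `2`. -/
theorem abs_fderiv_lineCutoff_le (a : ℝ) (x v : EuclideanSpace ℝ (Fin 1)) (hv : ‖v‖ ≤ 1) :
    |fderiv ℝ (lineCutoff a) x v|
      ≤ deriv Real.smoothTransition (x 0 + a) + deriv Real.smoothTransition (x 0 - a) := by
  have h0 : HasFDerivAt (fun x : EuclideanSpace ℝ (Fin 1) => x 0)
      (EuclideanSpace.proj 0 : EuclideanSpace ℝ (Fin 1) →L[ℝ] ℝ) x :=
    (EuclideanSpace.proj 0 : EuclideanSpace ℝ (Fin 1) →L[ℝ] ℝ).hasFDerivAt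
  have hd : ∀ t, HasDerivAt Real.smoothTransition (deriv Real.smoothTransition t) t := fun t =>
    ((Real.smoothTransition.contDiff (n := 1)).differentiable one_ne_zero t).hasDerivAt
  have h1 : fderiv ℝ (lineCutoff a) x = _ :=
    (((hd _).comp_hasFDerivAt x (h0.add_const a)).sub
      ((hd _).comp_hasFDerivAt x (h0.sub_const a))).fderiv
  have hv0 : |v 0| ≤ 1 := by rwa [← norm_eq_abs_apply_zero]
  have hp := deriv_smoothTransition_nonneg (x 0 + a)
  have hq := deriv_smoothTransition_nonneg (x 0 - a)
  rw [h1]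
  simp only [sub_apply, smul_apply, PiLp.proj_apply, smul_eq_mul, ← sub_mul, abs_mul]
  calc |deriv Real.smoothTransition (x 0 + a) - deriv Real.smoothTransition (x 0 - a)| * |v 0|
      ≤ |deriv Real.smoothTransition (x 0 + a) - deriv Real.smoothTransition (x 0 - a)| :=
        mul_le_of_le_one_right (abs_nonneg _) hv0
    _ ≤ _ := by rw [abs_le]; constructor <;> linarith

/-- The divergence is tested on widening cutoffs, each giving at most `2`. Dominated convergence
against the finite variation of `ν` then reaches the constant `1`. -/
theorem integral_chi_le_two_of_isDistribDiv
    {u : ↥(Set.univ : Set (EuclideanSpace ℝ (Fin 1))) → EuclideanSpace ℝ (Fin 1)}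
    {ν : SignedMeasure (Set.univ : Set (EuclideanSpace ℝ (Fin 1)))}
    (hd : IsDistribDiv Set.univ u ν) (hu : eLpNorm u ⊤ (lebesgueOn Set.univ) ≤ 1) :
    ∫ᵛ x, chi Set.univ x ∂•ν ≤ 2 := by
  have hu1 : ∀ᵐ x ∂(lebesgueOn (Set.univ : Set (EuclideanSpace ℝ (Fin 1)))), ‖u x‖ ≤ 1 := by
    rw [eLpNorm_exponent_top] at hu
    filter_upwards [ae_le_eLpNormEssSup (f := u) (μ := lebesgueOn Set.univ)] with x hx
    have := hx.trans hu
    rwa [← ofReal_norm, ENNReal.ofReal_le_one] at this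
  have hbound : ∀ n : ℕ, ∫ᵛ x, lineCutoff n x ∂•ν ≤ 2 := by
    intro n
    set G : ℝ → ℝ := fun t =>
      deriv Real.smoothTransition (t + n) + deriv Real.smoothTransition (t - n)
    have hI1 := integrable_deriv_smoothTransition.comp_add_right (n : ℝ)
    have hI2 := integrable_deriv_smoothTransition.comp_sub_right (n : ℝ)
    have hG : ∫ t, G t = 2 := by
      simp only [G]
      rw [integral_add hI1 hI2, integral_add_right_eq_self (deriv Real.smoothTransition),
        integral_sub_right_eq_self (deriv Real.smoothTransition), integral_deriv_smoothTransition]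
      norm_num
    have hGE : Integrable fun x : EuclideanSpace ℝ (Fin 1) => G (x 0) :=
      (measurePreserving_apply_zero.integrable_comp_emb measurableEmbedding_apply_zero).2
        (hI1.add hI2)
    have hGU : Integrable (fun x : (Set.univ : Set (EuclideanSpace ℝ (Fin 1))) => G (x.1 0))
        (lebesgueOn Set.univ) := by
      have := hGE.integrableOn (s := Set.univ)
      rwa [integrableOn_iff_comap_subtypeVal MeasurableSet.univ] at this
    have h := hd (lineCutoff n) (contDiff_lineCutoff n)
      (hasCompactSupport_lineCutoff n.cast_nonneg) (Set.subset_univ _)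
    have h2 : |∫ x : (Set.univ : Set (EuclideanSpace ℝ (Fin 1))),
        fderiv ℝ (lineCutoff n) (x : EuclideanSpace ℝ (Fin 1)) (u x) ∂(lebesgueOn Set.univ)| ≤ 2 := by
      rw [← hG, ← measurePreserving_apply_zero.integral_comp measurableEmbedding_apply_zero,
        ← setIntegral_univ (f := fun x : EuclideanSpace ℝ (Fin 1) => G (x 0)), ← integral_lebesgueOn MeasurableSet.univ (fun x => G (x 0)),
        ← Real.norm_eq_abs]
      refine norm_integral_le_of_norm_le hGU ?_
      filter_upwards [hu1] with x hx
      exact abs_fderiv_lineCutoff_le n x (u x) hx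
    rw [h] at h2
    have := (abs_le.1 h2).1
    linarith
  have hlim : Filter.Tendsto (fun n : ℕ => ∫ᵛ x, lineCutoff n x ∂•ν) Filter.atTop
      (𝓝 (∫ᵛ x, chi Set.univ x ∂•ν)) := by
    refine VectorMeasure.tendsto_integral_of_dominated_convergence (fun _ => 1)
      (fun n => ?_) (integrable_const _) (fun n => ?_) ?_
    · exact ((contDiff_lineCutoff n).continuous.comp continuous_subtype_val).aestronglyMeasurable
    · exact Filter.Eventually.of_forall fun x => abs_lineCutoff_le n x
    · refine Filter.Eventually.of_forall fun x => ?_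
      refine tendsto_const_nhds.congr' ?_
      filter_upwards [Filter.eventually_ge_atTop ⌈|x.1 0| + 1⌉₊] with n hn
      rw [lineCutoff_eq_one ((Nat.le_ceil _).trans (by exact_mod_cast hn)), chi_apply]
  exact le_of_tendsto' hlim hbound

theorem bfSeminorm_univ_eq_two :
    bfSeminorm (Set.univ : Set (EuclideanSpace ℝ (Fin 1))) (chi Set.univ) = 2 := by
  refine le_antisymm (sSup_le ?_) two_le_bfSeminorm_univ
  rintro r ⟨u, ν, -, hd, hu, rfl⟩
  exact EReal.coe_le_coe_iff.2 (integral_chi_le_two_of_isDistribDiv hd hu)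

/-! ### Measurability of the indicator and conclusion -/

theorem isCompletedSuslinSet_preimage_chi {m : ℕ} (U : Set (EuclideanSpace ℝ (Fin m)))
    (B : Set ℝ) : IsCompletedSuslinSet U (chi U ⁻¹' B) := by
  refine ⟨chi U ⁻¹' B, ?_, by simp⟩
  have : chi U = fun _ => (1 : ℝ) := funext chi_apply
  rw [this]
  exact @MeasurableSet.const U (suslinSigmaAlgebra U) ((1 : ℝ) ∈ B)

theorem bfSeminorm_eq_top_of_volume_eq_top {m : ℕ} (hm : 2 ≤ m)
    {U : Set (EuclideanSpace ℝ (Fin m))} (hU : IsOpen U) (hv : volume U = ⊤) :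
    bfSeminorm U (chi U) = ⊤ := by
  by_contra h
  -- A real number strictly between the seminorm and `⊤` serves as `C`, so the value `⊥` needs no
  -- separate treatment.
  obtain ⟨C, hC, -⟩ := EReal.lt_iff_exists_real_btwn.1 (lt_top_iff_ne_top.2 h)
  exact (volume_lt_top_of_bfSeminorm_le hm hU hC.le).ne hv

theorem mainTheorem8 :
    (∀ (m : ℕ), 2 ≤ m → ∀ U : Set (EuclideanSpace ℝ (Fin m)), IsOpen U →
        volume U = ⊤ → bfSeminorm U (chi U) = ⊤ ∧ ¬ HasFiniteAnexometer U) ∧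
      (volume (Set.univ : Set (EuclideanSpace ℝ (Fin 1))) = ⊤ ∧
        bfSeminorm (Set.univ : Set (EuclideanSpace ℝ (Fin 1))) (chi Set.univ) = 2 ∧
        HasFiniteAnexometer (Set.univ : Set (EuclideanSpace ℝ (Fin 1)))) := by
  refine ⟨fun m hm U hU hv => ?_, measure_univ_of_isAddLeftInvariant _, bfSeminorm_univ_eq_two,
    ⟨1, fun x => by simp [chi_apply]⟩, fun B _ => isCompletedSuslinSet_preimage_chi _ B, ?_⟩
  · have h := bfSeminorm_eq_top_of_volume_eq_top hm hU hv
    exact ⟨h, fun hf => hf.2.2.ne h⟩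
  · rw [bfSeminorm_univ_eq_two]
    exact EReal.coe_lt_top 2
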